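/- Let $L\ge 1$ and $d_0,\dots,d_L\ge 0$ be integers. A weight vector is a tuple $\theta=(W_L,\dots,W_1)$ of real matrices, $W_j\in\mathbb{R}^{d_j\times d_{j-1}}$; the set of all weight vectors is $\mathbb{R}^{d_\theta}$, $d_\theta=\sum_{j=1}^L d_jd_{j-1}$, with its usual topology. For $L\ge k\ge i\ge 0$ put $W_{k\sim i}=W_kW_{k-1}\cdots W_{i+1}$ (with $W_{k\sim k}=I$), and let $\mu(\theta)=W_{L\sim 0}$. The rank list of $\theta$ is $\langle \mathrm{rk}\,W_{k\sim i}\rangle_{L\ge k\ge i\ge 0}$. A list of natural numbers $\underline r=\langle r_{k\sim i}\rangle_{L\ge k\ge i\ge 0}$ is called a valid rank list if it is the rank list of some $\theta\in\mathbb{R}^{d_\theta}$ (so $r_{j\sim j}=d_j$). Its interval multiplicities are $$\omega_{ki}=r_{k\sim i}-r_{k\sim i-1}-r_{k+1\sim i}+r_{k+1\sim i-1}\qquad(L\ge k\ge i\ge 0),$$ with the convention $r_{L+1\sim x}=r_{y\sim -1}=0$; they determine $\underline r$. A rank-$1$ abstract connecting move takes a valid rank list and indices $L\ge l\ge k+1=i>h\ge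 0$ with $\omega_{li}\ge 1$ and $\omega_{kh}\ge 1$, and yields the rank list obtained by increasing $\omega_{lh}$ by $1$ and decreasing $\omega_{li}$ and $\omega_{kh}$ by $1$. A rank-$1$ abstract swapping move takes a valid rank list and indices $L\ge l>k\ge i>h\ge 0$ with $\omega_{li}\ge 1$ and $\omega_{kh}\ge 1$, and yields the rank list obtained by increasing $\omega_{lh}$ and $\omega_{ki}$ by $1$ and decreasing $\omega_{li}$ and $\omega_{kh}$ by $1$. All other multiplicities are unchanged. For $W\in\mathbb{R}^{d_L\times d_0}$ and a rank list $\underline r$ let $S_{\underline r}=\{\theta:\mu(\theta)=W,\ \theta\text{ has rank list }\underline r\}$, and let $\bar S$ denote the closure of $S$ in $\mathbb{R}^{d_\theta}$. **Theorem.** Let $W\in\mathbb{R}^{d_L\times d_0}$, and let $\underline r,\underline s$ be valid rank lists (for the same $d_0,\dots,d_L$) with $\mathrm{rk}\,W=r_{L\sim 0}=s_{L\sim 0}$. Then $S_{\underline r}$ and $S_{\underline s}$ are nonempty, and the following are equivalent: (A) $S_{\underline r}\subseteq\bar S_{\underline s}$; (B) $S_{\underline r}\cap\bar S_{\underline s}\ne\emptyset$;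 (C) $r_{k\sim i}\le s_{k\sim i}$ for all $L\ge k\ge i\ge 0$; (D) there is a finite (possibly empty) sequence of rank-$1$ abstract connecting and swapping moves that proceeds from $\underline r$ to $\underline s$, with all the intermediate rank lists valid. In particular, for every $W\in\mathbb{R}^{d_L\times d_0}$ the rank stratification $\{S_{\underline r}:\underline r\text{ is the rank list of some }\theta\in\mu^{-1}(W)\}$ of $\mu^{-1}(W)$ satisfies the frontier condition: for any two distinct members $S,T$, either $S\cap\bar T=\emptyset$ or $S\subseteq\bar T$. -/

import Mathlib

namespace LinNet

/-- The weight space of the linear network with unit layers of sizes `d 0, …, d L`: a weight vector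
is a tuple of real matrices, where `θ j`, for `j : Fin L`, is the factor matrix `W_{j+1}`, of size
`d_{j+1} × d_j`.  It carries the product topology, which is the usual topology of `ℝ^{d_θ}`. -/
abbrev Weights {L : ℕ} (d : Fin (L + 1) → ℕ) : Type :=
  (j : Fin L) → Matrix (Fin (d j.succ)) (Fin (d j.castSucc)) ℝ

/-- The subsequence matrix `W_{k∼i} = W_k W_{k-1} ⋯ W_{i+1}`, with `W_{i∼i} = 1`,
by recursion on `k`. -/
def subseq {L : ℕ} {d : Fin (L + 1) → ℕ} (θ : Weights d) (k i : Fin (L + 1)) (h : i ≤ k) :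
    Matrix (Fin (d k)) (Fin (d i)) ℝ :=
  Nat.leRec (n := i.val)
    (motive := fun m _ => (hm : m < L + 1) → Matrix (Fin (d ⟨m, hm⟩)) (Fin (d i)) ℝ)
    (fun _ => (1 : Matrix (Fin (d i)) (Fin (d i)) ℝ))
    (fun m _ M hm =>
      (show Matrix (Fin (d ⟨m + 1, hm⟩)) (Fin (d ⟨m, Nat.lt_of_succ_lt hm⟩)) ℝ from
        θ ⟨m, Nat.lt_of_succ_lt_succ hm⟩) * M (Nat.lt_of_succ_lt hm))
    h k.isLt

theorem subseq_self {L : ℕ} {d : Fin (L + 1) → ℕ} (θ : Weights d) (i : Fin (L + 1)) :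
    subseq θ i i le_rfl = 1 := by
  simp [subseq, Nat.leRec_self]

theorem subseq_succ {L : ℕ} {d : Fin (L + 1) → ℕ} (θ : Weights d) (j : Fin L) (i : Fin (L + 1))
    (h : i ≤ j.castSucc) :
    subseq θ j.succ i (h.trans j.castSucc_lt_succ.le) = θ j * subseq θ j.castSucc i h := by
  have h' : i.val ≤ j.val := h
  exact congrFun (Nat.leRec_succ (n := i.val)
    (motive := fun m _ => (hm : m < L + 1) → Matrix (Fin (d ⟨m, hm⟩)) (Fin (d i)) ℝ)
    (fun _ => (1 : Matrix (Fin (d i)) (Fin (d i)) ℝ))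
    (fun m _ M hm =>
      (show Matrix (Fin (d ⟨m + 1, hm⟩)) (Fin (d ⟨m, Nat.lt_of_succ_lt hm⟩)) ℝ from
        θ ⟨m, Nat.lt_of_succ_lt_succ hm⟩) * M (Nat.lt_of_succ_lt hm)) h') j.succ.isLt

/-- The matrix multiplication map `μ(W_L, …, W_1) = W_L ⋯ W_1`. -/
def mu {L : ℕ} {d : Fin (L + 1) → ℕ} (θ : Weights d) :
    Matrix (Fin (d (Fin.last L))) (Fin (d 0)) ℝ :=
  subseq θ (Fin.last L) 0 (Fin.zero_le _)

/-- A list `⟨r_{k∼i}⟩` of natural numbers indexed by `L ≥ k ≥ i ≥ 0`. -/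
abbrev RankList (L : ℕ) : Type :=
  (k i : Fin (L + 1)) → i ≤ k → ℕ

/-- The rank list of a weight vector: the ranks of all its subsequence matrices. -/
noncomputable def rankList {L : ℕ} {d : Fin (L + 1) → ℕ} (θ : Weights d) : RankList L :=
  fun k i h => (subseq θ k i h).rank

/-- A list is a valid rank list for layer sizes `d` if it is the rank list of some weight vector. -/
def IsValid {L : ℕ} (d : Fin (L + 1) → ℕ) (r : RankList L) : Prop :=
  ∃ θ : Weights d, rankList θ = r

/-- The fiber `μ⁻¹(W)`. -/
def fiber {L : ℕ} {d : Fin (L + 1) → ℕ}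
    (W : Matrix (Fin (d (Fin.last L))) (Fin (d 0)) ℝ) : Set (Weights d) :=
  {θ | mu θ = W}

/-- The stratum `S_r` of the fiber of `W`: its points with rank list `r`. -/
def stratum {L : ℕ} {d : Fin (L + 1) → ℕ}
    (W : Matrix (Fin (d (Fin.last L))) (Fin (d 0)) ℝ) (r : RankList L) : Set (Weights d) :=
  {θ | θ ∈ fiber W ∧ rankList θ = r}

/-- The rank stratification of the fiber of `W`: all strata `S_r`, where `r` is the rank list of
some weight vector in the fiber. -/
def rankStratification {L : ℕ} {d : Fin (L + 1) → ℕ}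
    (W : Matrix (Fin (d (Fin.last L))) (Fin (d 0)) ℝ) : Set (Set (Weights d)) :=
  {S | ∃ r : RankList L, (∃ θ ∈ fiber W, rankList θ = r) ∧ S = stratum W r}

/-- The frontier condition for a family of subsets (strata) of a topological space. -/
def FrontierCondition {X : Type*} [TopologicalSpace X] (𝒮 : Set (Set X)) : Prop :=
  ∀ S ∈ 𝒮, ∀ T ∈ 𝒮, S ≠ T → S ∩ closure T = ∅ ∨ S ⊆ closure T

/-- `r_{k∼i}` as an integer; in particular it is `0` for `k = L + 1`. -/
def entry {L : ℕ} (r : RankList L) (k i : ℕ) : ℤ :=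
  if h : i ≤ k ∧ k ≤ L then
    (r ⟨k, Nat.lt_succ_of_le h.2⟩ ⟨i, Nat.lt_succ_of_le (h.1.trans h.2)⟩ h.1 : ℤ)
  else 0

/-- `r_{k∼i-1}`, with the convention `r_{k∼-1} = 0`. -/
def entryPred {L : ℕ} (r : RankList L) (k : ℕ) : ℕ → ℤ
  | 0 => 0
  | i + 1 => entry r k i

/-- The interval multiplicity
`ω_{ki} = r_{k∼i} - r_{k∼i-1} - r_{k+1∼i} + r_{k+1∼i-1}` for `L ≥ k ≥ i ≥ 0`. -/
def mult {L : ℕ} (r : RankList L) (k i : ℕ) : ℤ :=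
  entry r k i - entryPred r k i - entry r (k + 1) i + entryPred r (k + 1) i

/-- `s` is obtained from the valid rank list `r` by the rank-`c` abstract connecting move with
index tuple `(l, k, i, h)`. -/
structure IsConnectingMove {L : ℕ} (d : Fin (L + 1) → ℕ) (c l k i h : ℕ)
    (r s : RankList L) : Prop where
  valid : IsValid d r
  le_top : l ≤ L
  lt_left : k + 1 ≤ l
  adjacent : i = k + 1
  lt_right : h < i
  enough_left : (c : ℤ) ≤ mult r l i
  enough_right : (c : ℤ) ≤ mult r k h
  mult_eq : ∀ y x : ℕ, x ≤ y → y ≤ L →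
    mult s y x = mult r y x
      + (if y = l ∧ x = h then (c : ℤ) else 0)
      - (if y = l ∧ x = i then (c : ℤ) else 0)
      - (if y = k ∧ x = h then (c : ℤ) else 0)

/-- `s` is obtained from the valid rank list `r` by the rank-`c` abstract swapping move with
index tuple `(l, k, i, h)`. -/
structure IsSwappingMove {L : ℕ} (d : Fin (L + 1) → ℕ) (c l k i h : ℕ)
    (r s : RankList L) : Prop where
  valid : IsValid d r
  le_top : l ≤ L
  lt_left : k < l
  overlap : i ≤ k
  lt_right : h < i
  enough_left : (c : ℤ) ≤ mult r l i
  enough_right : (c : ℤ) ≤ mult r k h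
  mult_eq : ∀ y x : ℕ, x ≤ y → y ≤ L →
    mult s y x = mult r y x
      + (if y = l ∧ x = h then (c : ℤ) else 0)
      + (if y = k ∧ x = i then (c : ℤ) else 0)
      - (if y = l ∧ x = i then (c : ℤ) else 0)
      - (if y = k ∧ x = h then (c : ℤ) else 0)

/-- `s` is a valid rank list obtained from the valid rank list `r` by one rank-one abstract
connecting or swapping move. -/
def RankOneMove {L : ℕ} (d : Fin (L + 1) → ℕ) (r s : RankList L) : Prop :=
  IsValid d r ∧ IsValid d s ∧
    ∃ l k i h : ℕ, IsConnectingMove d 1 l k i h r s ∨ IsSwappingMove d 1 l k i h r s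

end LinNet

namespace LinNet

/-! ### Linear maps: rank–nullity on a subspace, and equivalence by rank. -/

section LinearAlgebra

open Module

/-! View the ranks as an array over pairs `(y, x)`. Either kind of move adds `1` on a rectangle `k <
y ≤ l`, `h ≤ x < i`, since the mixed second difference of its indicator lives at the four corners;
the move is connecting when `i = k + 1` and swapping when `i ≤ k`.

(D) ⇒ (A): by `exists_mult_eq`, multiplicities are Frobenius defects, so positive ones give a vector
`w` born in layer `i` and dying after layer `l`, and a `z` born in layer `h` and dying after layer
`k`. Adding `ε u vᵀ` to the factor from layer `k` to `k + 1`, with `u` the image of `w` and `v` a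
functional detecting `z`, raises exactly the ranks in the rectangle (`exists_perturb`). The product
is unchanged unless the rectangle contains `(L, 0)`, which is excluded because the rank of `W` is
fixed.

(A) ⇒ (B) needs nonemptiness: base changes in the two end layers turn the product into any matrix of
equal rank. (B) ⇒ (C) is lower semicontinuity of rank.

(C) ⇒ (D): `exists_rect` finds a rectangle inside the support of `s - r` at whose corners `(l, i)`
and `(k, h)` the multiplicities of `r` exceed those of `s`, which are nonnegative. The move is thus
legal and stays below `s`; induct on the total gap. -/

theorem finrank_map_add_finrank_inf_ker {K F G : Type*} [Field K] [AddCommGroup F] [Module K F]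
    [FiniteDimensional K F] [AddCommGroup G] [Module K G] (C : F →ₗ[K] G) (S : Submodule K F) :
    finrank K (S.map C) + finrank K (S ⊓ LinearMap.ker C : Submodule K F) = finrank K S := by
  rw [← (C.domRestrict S).finrank_range_add_finrank_ker, LinearMap.range_domRestrict,
    LinearMap.ker_domRestrict, ← Submodule.finrank_map_subtype_eq S, Submodule.map_comap_subtype]

/-- Two linear maps of equal rank are equivalent. -/
theorem exists_linearEquiv_comp_eq_of_finrank_range_eq {K E F : Type*} [Field K]
    [AddCommGroup E] [Module K E] [FiniteDimensional K E]
    [AddCommGroup F] [Module K F] [FiniteDimensional K F] (f g : E →ₗ[K] F)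
    (hfg : finrank K (LinearMap.range f) = finrank K (LinearMap.range g)) :
    ∃ (a : E ≃ₗ[K] E) (b : F ≃ₗ[K] F), ∀ x, b (f x) = g (a x) := by
  obtain ⟨f', hf'⟩ := (LinearMap.ker f).exists_isCompl
  obtain ⟨g', hg'⟩ := (LinearMap.ker g).exists_isCompl
  obtain ⟨p, hp⟩ := (LinearMap.range f).exists_isCompl
  obtain ⟨q, hq⟩ := (LinearMap.range g).exists_isCompl
  have e1 := Submodule.finrank_add_eq_of_isCompl hp
  have e2 := Submodule.finrank_add_eq_of_isCompl hq
  have e3 := f.finrank_range_add_finrank_ker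
  have e4 := g.finrank_range_add_finrank_ker
  let α : LinearMap.range f ≃ₗ[K] LinearMap.range g := LinearEquiv.ofFinrankEq _ _ hfg
  let γ : LinearMap.ker f ≃ₗ[K] LinearMap.ker g := LinearEquiv.ofFinrankEq _ _ (by omega)
  let δ : p ≃ₗ[K] q := LinearEquiv.ofFinrankEq _ _ (by omega)
  let φ : f' ≃ₗ[K] LinearMap.range f :=
    (Submodule.quotientEquivOfIsCompl _ _ hf').symm ≪≫ₗ f.quotKerEquivRange
  let ψ : g' ≃ₗ[K] LinearMap.range g :=
    (Submodule.quotientEquivOfIsCompl _ _ hg').symm ≪≫ₗ g.quotKerEquivRange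
  have hφ : ∀ x, (φ x : F) = f x := fun x => by simp [φ]
  have hψ : ∀ x, (ψ x : F) = g x := fun x => by simp [ψ]
  let P := Submodule.prodEquivOfIsCompl _ _ hf'
  let Q := Submodule.prodEquivOfIsCompl _ _ hg'
  let R := Submodule.prodEquivOfIsCompl _ _ hp
  let S := Submodule.prodEquivOfIsCompl _ _ hq
  -- On the source, kernels are matched arbitrarily and complements through the ranges; on the
  -- target, `α` matches ranges and `δ` their complements.
  refine ⟨P.symm ≪≫ₗ (γ.prodCongr (φ ≪≫ₗ α ≪≫ₗ ψ.symm)) ≪≫ₗ Q,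
    R.symm ≪≫ₗ (α.prodCongr δ) ≪≫ₗ S, fun x => ?_⟩
  obtain ⟨⟨u, v⟩, rfl⟩ := P.surjective x
  have h1 : f (P (u, v)) = R (φ v, 0) := by
    simp [P, R, hφ]
  have h2 : g (Q (γ u, ψ.symm (α (φ v)))) = α (φ v) := by
    have := (γ u).2
    rw [LinearMap.mem_ker] at this
    simp [Q, this, ← hψ]
  rw [h1]
  simp only [LinearEquiv.trans_apply, LinearEquiv.symm_apply_apply, LinearEquiv.prodCongr_apply,
    h2]
  simp [S]

end LinearAlgebra

/-! ### Effect of a rank-one update on the rank. -/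

section RankOneUpdate

open Matrix Module

variable {m n : Type*}

theorem vecMulVec_zero_right {R : Type*} [CommSemiring R] (a : m → R) :
    vecMulVec a (0 : n → R) = 0 := by
  ext
  simp [vecMulVec_apply]

variable [Fintype n]

theorem add_smul_vecMulVec_mulVec {R : Type*} [CommSemiring R] (M : Matrix m n R) (a : m → R)
    (b x : n → R) (ε : R) :
    (M + ε • vecMulVec a b) *ᵥ x = M *ᵥ x + (ε * (b ⬝ᵥ x)) • a := by
  rw [add_mulVec, smul_mulVec, vecMulVec_mulVec]
  ext j
  simp [mul_comm, mul_left_comm]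

/-- A rank-one update along a vector `M c` of the range does not change the rank, unless a certain
scalar vanishes. -/
theorem rank_add_smul_vecMulVec_of_mem {K : Type*} [Field K] (M : Matrix m n K) (b c : n → K)
    (ε : K) (h : 1 + ε * (b ⬝ᵥ c) ≠ 0) :
    (M + ε • vecMulVec (M *ᵥ c) b).rank = M.rank := by
  suffices LinearMap.range (M + ε • vecMulVec (M *ᵥ c) b).mulVecLin =
    LinearMap.range M.mulVecLin by rw [Matrix.rank, this, Matrix.rank]
  apply le_antisymm
  · rintro _ ⟨x, rfl⟩
    refine ⟨x + (ε * (b ⬝ᵥ x)) • c, ?_⟩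
    simp only [mulVecLin_apply, add_smul_vecMulVec_mulVec, mulVec_add, mulVec_smul]
  · rintro _ ⟨x, rfl⟩
    -- The coefficient is the one that cancels the `M *ᵥ c` component of the image, as in
    -- Sherman–Morrison.
    refine ⟨x - ((1 + ε * (b ⬝ᵥ c))⁻¹ * (ε * (b ⬝ᵥ x))) • c, ?_⟩
    simp only [mulVecLin_apply, add_smul_vecMulVec_mulVec, mulVec_sub, mulVec_smul]
    rw [add_sub_assoc, add_eq_left, sub_eq_zero, smul_add, smul_smul, ← add_smul]
    congr 1
    field_simp

/-- A rank-one update along a vector outside the range, by a functional nonzero on the kernel,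
increases the rank by one. -/
theorem rank_add_smul_vecMulVec_of_notMem {K : Type*} [Field K] [Finite m] (M : Matrix m n K) (a : m → K)
    (b z : n → K) (ε : K) (hε : ε ≠ 0) (ha : a ∉ LinearMap.range M.mulVecLin)
    (hz : M *ᵥ z = 0) (hbz : b ⬝ᵥ z ≠ 0) :
    (M + ε • vecMulVec a b).rank = M.rank + 1 := by
  suffices LinearMap.range (M + ε • vecMulVec a b).mulVecLin =
    LinearMap.range M.mulVecLin ⊔ Submodule.span K {a} by
      rw [Matrix.rank, this, Submodule.finrank_sup_span_singleton ha, Matrix.rank]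
  apply le_antisymm
  · rintro _ ⟨x, rfl⟩
    rw [mulVecLin_apply, add_smul_vecMulVec_mulVec]
    exact Submodule.add_mem_sup ⟨x, rfl⟩
      (Submodule.smul_mem _ _ (Submodule.mem_span_singleton_self a))
  · have hmem : a ∈ LinearMap.range (M + ε • vecMulVec a b).mulVecLin := by
      refine ⟨(ε * (b ⬝ᵥ z))⁻¹ • z, ?_⟩
      rw [mulVecLin_apply, mulVec_smul, add_smul_vecMulVec_mulVec, hz, zero_add,
        inv_smul_smul₀ (mul_ne_zero hε hbz)]
    refine sup_le ?_ ((Submodule.span_singleton_le_iff_mem _ _).2 hmem)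
    rintro _ ⟨x, rfl⟩
    have := Submodule.sub_mem _ (LinearMap.mem_range_self (M + ε • vecMulVec a b).mulVecLin x)
      (Submodule.smul_mem _ (ε * (b ⬝ᵥ x)) hmem)
    simpa only [mulVecLin_apply, add_smul_vecMulVec_mulVec, add_sub_cancel_right] using this

end RankOneUpdate

/-! ### Frobenius inequality, equivalence of matrices, semicontinuity of rank. -/

section MatrixForms

open Matrix Module

/-- Separation by a dual vector, put in dot-product form so that the functional can be a factor of a
rank-one matrix. -/
theorem exists_dotProduct_eq_zero_of_notMem {K n : Type*} [Field K] [Fintype n]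
    (p : Submodule K (n → K)) {x : n → K} (hx : x ∉ p) :
    ∃ v : n → K, (∀ y ∈ p, v ⬝ᵥ y = 0) ∧ v ⬝ᵥ x ≠ 0 := by
  classical
  obtain ⟨f, hfx, hf⟩ := p.exists_dual_map_eq_bot_of_notMem hx inferInstance
  have hfv : ∀ y, (dotProductEquiv K n).symm f ⬝ᵥ y = f y := fun y =>
    LinearMap.congr_fun ((dotProductEquiv K n).apply_symm_apply f) y
  refine ⟨(dotProductEquiv K n).symm f, fun y hy => ?_, by rwa [hfv]⟩
  rw [hfv]
  exact (Submodule.mem_bot K).1 (hf ▸ Submodule.mem_map_of_mem hy)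

theorem rank_mul_add_finrank_inf_ker {K e f g : Type*} [Field K] [Fintype e] [Fintype f]
    [Finite g] (A : Matrix f e K) (C : Matrix g f K) :
    (C * A).rank + finrank K
      (LinearMap.range A.mulVecLin ⊓ LinearMap.ker C.mulVecLin : Submodule K (f → K)) =
        A.rank := by
  rw [Matrix.rank, mulVecLin_mul, LinearMap.range_comp, finrank_map_add_finrank_inf_ker,
    Matrix.rank]

theorem range_mulVecLin_mul_le {K e f h : Type*} [CommSemiring K] [Fintype e] [Fintype h]
    (A : Matrix f e K) (B : Matrix e h K) :
    LinearMap.range (A * B).mulVecLin ≤ LinearMap.range A.mulVecLin := by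
  rw [mulVecLin_mul]
  exact LinearMap.range_comp_le_range _ _

/-- The Frobenius rank inequality. -/
theorem rank_mul_add_rank_mul_le {K e f g h : Type*} [Field K] [Fintype e] [Fintype f]
    [Finite g] [Fintype h] (A : Matrix f e K) (B : Matrix e h K) (C : Matrix g f K) :
    (A * B).rank + (C * A).rank ≤ A.rank + (C * A * B).rank := by
  -- The two rank drops under `C` are the dimensions of `range A ⊓ ker C` and `range (A * B) ⊓ ker
  -- C`, and the second space lies in the first.
  have h1 := rank_mul_add_finrank_inf_ker A C
  have h2 := rank_mul_add_finrank_inf_ker (A * B) C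
  have h3 := Submodule.finrank_mono
    (inf_le_inf_right (LinearMap.ker C.mulVecLin) (range_mulVecLin_mul_le A B))
  rw [← Matrix.mul_assoc] at h2
  omega

/-- If the Frobenius rank inequality is strict, some vector killed by `C * A` is mapped by `A`
outside the range of `A * B`. -/
theorem exists_mulVec_eq_zero_notMem_range {K e f g h : Type*} [Field K] [Fintype e]
    [Fintype f] [Finite g] [Fintype h] (A : Matrix f e K) (B : Matrix e h K) (C : Matrix g f K)
    (hlt : (A * B).rank + (C * A).rank < A.rank + (C * A * B).rank) :
    ∃ w, (C * A) *ᵥ w = 0 ∧ A *ᵥ w ∉ LinearMap.range (A * B).mulVecLin := by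
  by_contra! hcon
  have hle : LinearMap.range A.mulVecLin ⊓ LinearMap.ker C.mulVecLin ≤
      LinearMap.range (A * B).mulVecLin ⊓ LinearMap.ker C.mulVecLin := by
    rintro _ ⟨⟨w, rfl⟩, hw⟩
    refine ⟨hcon w ?_, hw⟩
    rw [← mulVec_mulVec]
    exact hw
  have h1 := rank_mul_add_finrank_inf_ker A C
  have h2 := rank_mul_add_finrank_inf_ker (A * B) C
  have h3 := Submodule.finrank_mono hle
  rw [← Matrix.mul_assoc] at h2
  omega

/-- Two matrices of equal rank are equivalent. -/
theorem exists_mul_mul_eq_of_rank_eq {K m n : Type*} [Field K] [Fintype m] [Fintype n]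
    [DecidableEq m] [DecidableEq n] (A B : Matrix m n K) (h : A.rank = B.rank) :
    ∃ (P P' : Matrix m m K) (Q Q' : Matrix n n K), P' * P = 1 ∧ Q' * Q = 1 ∧ P * A * Q' = B := by
  obtain ⟨a, b, hab⟩ := exists_linearEquiv_comp_eq_of_finrank_range_eq A.mulVecLin B.mulVecLin h
  refine ⟨LinearMap.toMatrix' b.toLinearMap, LinearMap.toMatrix' b.symm.toLinearMap,
    LinearMap.toMatrix' a.toLinearMap, LinearMap.toMatrix' a.symm.toLinearMap, ?_, ?_, ?_⟩
  · rw [← LinearMap.toMatrix'_comp]; simp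
  · rw [← LinearMap.toMatrix'_comp]; simp
  · apply Matrix.toLin'.injective
    refine LinearMap.ext fun x => ?_
    simpa [Matrix.toLin'_mul] using hab (a.symm x)

/-- The rank of a matrix is lower semicontinuous. -/
theorem isOpen_setOf_le_rank {m n : Type*} [Fintype m] [Fintype n] (c : ℕ) :
    IsOpen {A : Matrix m n ℝ | c ≤ A.rank} := by
  classical
  have hcont : Continuous fun A : Matrix m n ℝ =>
      LinearMap.toContinuousLinearMap (Matrix.toLin' A) :=
    (LinearMap.toContinuousLinearMap.toLinearMap ∘ₗ
      (Matrix.toLin' : Matrix m n ℝ ≃ₗ[ℝ] _).toLinearMap).continuous_of_finiteDimensional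
  have := (isOpen_setOfPred_nat_le_rank (𝕜 := ℝ) (E := n → ℝ) (F := m → ℝ) c).preimage hcont
  convert this using 1
  ext A
  simp only [Set.mem_ofPred_eq, Set.mem_preimage, Matrix.rank, LinearMap.rank]
  rw [← Module.finrank_eq_rank, Nat.cast_le]
  rfl

end MatrixForms
-- Subsequence matrices, perturbations, and multiplicities as Frobenius defects.
section Network

open Matrix Filter Topology

variable {L : ℕ} {d : Fin (L + 1) → ℕ}

theorem subseq_mul_subseq (θ : Weights d) (k j i : Fin (L + 1)) (hij : i ≤ j) (hjk : j ≤ k) :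
    subseq θ k j hjk * subseq θ j i hij = subseq θ k i (hij.trans hjk) := by
  induction k using Fin.induction with
  | zero =>
    obtain rfl : j = 0 := le_antisymm hjk (Fin.zero_le _)
    rw [subseq_self, Matrix.one_mul]
  | succ k ih =>
    rcases hjk.lt_or_eq with h | h
    · have h' : j ≤ k.castSucc := Fin.le_castSucc_iff.2 h
      rw [subseq_succ θ k j h', subseq_succ θ k i (hij.trans h'), Matrix.mul_assoc, ih h']
    · subst h
      rw [subseq_self, Matrix.one_mul]

theorem subseq_mulVec_subseq (θ : Weights d) (k j i : Fin (L + 1)) (hij : i ≤ j) (hjk : j ≤ k)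
    (x : Fin (d i) → ℝ) :
    subseq θ k j hjk *ᵥ (subseq θ j i hij *ᵥ x) = subseq θ k i (hij.trans hjk) *ᵥ x := by
  rw [mulVec_mulVec, subseq_mul_subseq]

/-- A subsequence matrix only depends on the factors it multiplies. -/
theorem subseq_congr (θ θ' : Weights d) (k i : Fin (L + 1)) (hik : i ≤ k)
    (h : ∀ j : Fin L, i ≤ j.castSucc → j.succ ≤ k → θ j = θ' j) :
    subseq θ k i hik = subseq θ' k i hik := by
  induction k using Fin.induction with
  | zero =>
    obtain rfl : i = 0 := le_antisymm hik (Fin.zero_le _)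
    rw [subseq_self, subseq_self]
  | succ k ih =>
    rcases hik.lt_or_eq with h' | h'
    · have hk : i ≤ k.castSucc := Fin.le_castSucc_iff.2 h'
      rw [subseq_succ θ k i hk, subseq_succ θ' k i hk, h k hk le_rfl,
        ih hk fun j h1 h2 => h j h1 (h2.trans k.castSucc_lt_succ.le)]
    · subst h'
      rw [subseq_self, subseq_self]

theorem continuous_subseq (k i : Fin (L + 1)) (hik : i ≤ k) :
    Continuous fun θ : Weights d => subseq θ k i hik := by
  induction k using Fin.induction with
  | zero =>
    obtain rfl : i = 0 := le_antisymm hik (Fin.zero_le _)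
    simp only [subseq_self]
    exact continuous_const
  | succ k ih =>
    rcases hik.lt_or_eq with h' | h'
    · have hk : i ≤ k.castSucc := Fin.le_castSucc_iff.2 h'
      simp only [fun θ => subseq_succ (d := d) θ k i hk]
      exact (continuous_apply k).matrix_mul (ih hk)
    · subst h'
      simp only [subseq_self]
      exact continuous_const

/-- Add `ε` times the rank-one matrix `u vᵀ` to the factor with index `k`. -/
def perturb (θ : Weights d) (k : Fin L) (u : Fin (d k.succ) → ℝ) (v : Fin (d k.castSucc) → ℝ)
    (ε : ℝ) : Weights d :=
  Function.update θ k (θ k + ε • vecMulVec u v)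

theorem tendsto_perturb (θ : Weights d) (k : Fin L) (u : Fin (d k.succ) → ℝ)
    (v : Fin (d k.castSucc) → ℝ) : Tendsto (perturb θ k u v) (𝓝[≠] 0) (𝓝 θ) := by
  have h : Continuous (perturb θ k u v) := by
    unfold perturb
    fun_prop
  have h0 : perturb θ k u v 0 = θ := by simp [perturb]
  simpa only [h0] using (h.tendsto 0).mono_left nhdsWithin_le_nhds

theorem subseq_perturb_of_notMem (θ : Weights d) (k : Fin L) (u : Fin (d k.succ) → ℝ)
    (v : Fin (d k.castSucc) → ℝ) (ε : ℝ) (y x : Fin (L + 1)) (hxy : x ≤ y)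
    (h : ¬ (k.succ ≤ y ∧ x ≤ k.castSucc)) :
    subseq (perturb θ k u v ε) y x hxy = subseq θ y x hxy := by
  refine subseq_congr _ _ _ _ _ fun j h1 h2 => ?_
  have : j ≠ k := by
    rintro rfl
    exact h ⟨h2, h1⟩
  exact Function.update_of_ne this _ _

/-- The perturbed factor occurs once in the product, so the dependence on `ε` is exactly affine. -/
theorem subseq_perturb (θ : Weights d) (k : Fin L) (u : Fin (d k.succ) → ℝ)
    (v : Fin (d k.castSucc) → ℝ) (ε : ℝ) (y x : Fin (L + 1)) (hy : k.succ ≤ y)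
    (hx : x ≤ k.castSucc) (hxy : x ≤ y) :
    subseq (perturb θ k u v ε) y x hxy = subseq θ y x hxy +
      ε • vecMulVec (subseq θ y k.succ hy *ᵥ u) (v ᵥ* subseq θ k.castSucc x hx) := by
  have hk : k.castSucc ≤ k.succ := k.castSucc_lt_succ.le
  rw [← subseq_mul_subseq _ y k.succ x (hx.trans hk) hy,
    ← subseq_mul_subseq θ y k.succ x (hx.trans hk) hy, subseq_succ _ k x hx, subseq_succ _ k x hx,
    subseq_perturb_of_notMem _ _ _ _ _ y _ _ (by simp),
    subseq_perturb_of_notMem _ _ _ _ _ k.castSucc _ _ (by simp)]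
  have : perturb θ k u v ε k = θ k + ε • vecMulVec u v := Function.update_self _ _ _
  rw [this, Matrix.add_mul, Matrix.mul_add, Matrix.smul_mul, Matrix.mul_smul, vecMulVec_mul,
    mul_vecMulVec]

theorem entry_eq (r : RankList L) (k i : Fin (L + 1)) (h : i ≤ k) : entry r k i = r k i h :=
  dif_pos ⟨h, Nat.lt_succ_iff.1 k.2⟩

theorem entry_of_gt (r : RankList L) {k : ℕ} (i : ℕ) (h : L < k) : entry r k i = 0 :=
  dif_neg (by omega)

/-- The interval multiplicity `ω_{KI}` is the defect in the Frobenius rank inequality for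
suitable matrices `B`, `W_{K∼I}`, `C`. -/
theorem exists_mult_eq (θ : Weights d) (K I : Fin (L + 1)) (hIK : I ≤ K) :
    ∃ (p q : ℕ) (B : Matrix (Fin (d I)) (Fin p) ℝ) (C : Matrix (Fin q) (Fin (d K)) ℝ),
      mult (rankList θ) K I = (subseq θ K I hIK).rank - (subseq θ K I hIK * B).rank -
        (C * subseq θ K I hIK).rank + (C * subseq θ K I hIK * B).rank ∧
      (∀ x : Fin (L + 1), (h : x < I) → LinearMap.range (subseq θ K x (h.le.trans hIK)).mulVecLin ≤
        LinearMap.range (subseq θ K I hIK * B).mulVecLin) ∧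
      ∀ y : Fin (L + 1), (h : K < y) → ∀ w, (C * subseq θ K I hIK) *ᵥ w = 0 →
        subseq θ y I (hIK.trans h.le) *ᵥ w = 0 := by
  obtain ⟨i, hi⟩ : ∃ i, i = I.val := ⟨_, rfl⟩
  obtain ⟨l, hl'⟩ : ∃ l, l = K.val := ⟨_, rfl⟩
  have hl : l ≤ L := by omega
  have hil : i ≤ l := by rw [hi, hl']; exact hIK
  rw [← hi, ← hl']
  obtain ⟨p, B, hB1, hB2⟩ : ∃ (p : ℕ) (B : Matrix (Fin (d I)) (Fin p) ℝ),
      (∀ y : Fin (L + 1), (h : I ≤ y) →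
        ((subseq θ y I h * B).rank : ℤ) = entryPred (rankList θ) y i) ∧
      ∀ x : Fin (L + 1), (h : x < I) → LinearMap.range (subseq θ K x (h.le.trans hIK)).mulVecLin ≤
        LinearMap.range (subseq θ K I hIK * B).mulVecLin := by
    -- `B` is the product from layer `i - 1` to `i`; for `i = 0` a matrix with no columns realizes
    -- the convention `r_{y∼-1} = 0`. Likewise `C` below is one factor, or has no rows at the top
    -- layer.
    rcases Nat.eq_zero_or_pos i with h0 | h0
    · refine ⟨0, 0, fun y h => ?_, fun x h => absurd (Fin.lt_def.1 h) (by omega)⟩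
      simp [h0, entryPred]
    · obtain ⟨i, rfl⟩ : ∃ i', i = i' + 1 := ⟨i - 1, by omega⟩
      have hJI : (⟨i, by omega⟩ : Fin (L + 1)) ≤ I := Fin.le_def.2 (by simp only; omega)
      refine ⟨_, subseq θ I ⟨i, by omega⟩ hJI, fun y h => ?_, fun x h => ?_⟩
      · rw [subseq_mul_subseq]
        have hy : i ≤ y.val ∧ y.val ≤ L := by
          have := Fin.le_def.1 h
          omega
        simp only [entryPred, entry, dif_pos hy]
        rfl
      · have hx : x ≤ ⟨i, by omega⟩ := by
          have := Fin.lt_def.1 h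
          exact Fin.le_def.2 (by simp only; omega)
        rw [subseq_mul_subseq, ← subseq_mul_subseq θ K _ x hx (hJI.trans hIK)]
        exact range_mulVecLin_mul_le _ _
  obtain ⟨q, C, hC1, hC2, hC3⟩ : ∃ (q : ℕ) (C : Matrix (Fin q) (Fin (d K)) ℝ),
      ((C * subseq θ K I hIK).rank : ℤ) = entry (rankList θ) (l + 1) i ∧
      ((C * subseq θ K I hIK * B).rank : ℤ) = entryPred (rankList θ) (l + 1) i ∧
      ∀ y : Fin (L + 1), (h : K < y) → ∀ w, (C * subseq θ K I hIK) *ᵥ w = 0 →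
        subseq θ y I (hIK.trans h.le) *ᵥ w = 0 := by
    rcases hl.lt_or_eq with h0 | h0
    · let N : Fin (L + 1) := ⟨l + 1, by omega⟩
      have hKN : K ≤ N := Fin.le_def.2 (by simp only [N]; omega)
      refine ⟨_, subseq θ N K hKN, ?_, ?_, fun y h w hw => ?_⟩
      · rw [subseq_mul_subseq]
        rw [hi]
        exact (entry_eq (rankList θ) N I _).symm
      · rw [subseq_mul_subseq]
        exact hB1 N (hIK.trans hKN)
      · have hNy : N ≤ y := by
          have := Fin.lt_def.1 h
          exact Fin.le_def.2 (by simp only [N]; omega)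
        rw [subseq_mul_subseq] at hw
        rw [← subseq_mulVec_subseq θ y N I (hIK.trans hKN) hNy, hw, mulVec_zero]
    · have hz : ∀ i, entry (rankList θ) (l + 1) i = 0 := fun i =>
        entry_of_gt _ i (by omega)
      refine ⟨0, 0, ?_, ?_, fun y h => absurd (Fin.lt_def.1 h) (by omega)⟩
      · simp [hz]
      · cases i <;> simp [entryPred, hz]
  have hA : ((subseq θ K I hIK).rank : ℤ) = entry (rankList θ) l i := by
    rw [hi, hl']
    exact (entry_eq (rankList θ) K I _).symm
  refine ⟨p, q, B, C, ?_, hB2, hC3⟩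
  rw [mult, hA, hC1, hC2, hB1 K hIK, ← hl']

theorem mult_rankList_nonneg (θ : Weights d) (K I : Fin (L + 1)) (hIK : I ≤ K) :
    0 ≤ mult (rankList θ) K I := by
  obtain ⟨p, q, B, C, hm, -, -⟩ := exists_mult_eq θ K I hIK
  have := rank_mul_add_rank_mul_le (subseq θ K I hIK) B C
  omega

/-- A positive interval multiplicity yields a vector of layer `i` that survives exactly up to
layer `l`, and whose image there does not come from below layer `i`. -/
theorem exists_vector_of_one_le_mult (θ : Weights d) (K I : Fin (L + 1)) (hIK : I ≤ K)
    (hm : 1 ≤ mult (rankList θ) K I) :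
    ∃ w : Fin (d I) → ℝ,
      (∀ y : Fin (L + 1), (h : K < y) → subseq θ y I (hIK.trans h.le) *ᵥ w = 0) ∧
      subseq θ K I hIK *ᵥ w ≠ 0 ∧
      ∀ x : Fin (L + 1), (h : x < I) → subseq θ K I hIK *ᵥ w ∉
        LinearMap.range (subseq θ K x (h.le.trans hIK)).mulVecLin := by
  obtain ⟨p, q, B, C, hmult, hB, hC⟩ := exists_mult_eq θ K I hIK
  obtain ⟨w, hw0, hw1⟩ := exists_mulVec_eq_zero_notMem_range (subseq θ K I hIK) B C (by omega)
  refine ⟨w, fun y h => hC y h w hw0, fun h => hw1 ?_, fun x h hx => hw1 (hB x h hx)⟩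
  exact h ▸ Submodule.zero_mem _

end Network
-- Realizing a move by an arbitrarily small perturbation.
section Perturbation

open Matrix Filter Topology

variable {L : ℕ} {d : Fin (L + 1) → ℕ}

/-- Increase by one the entries `r_{y∼x}` with `k < y ≤ l` and `h ≤ x < i`. -/
def addRect (r : RankList L) (l k i h : ℕ) : RankList L := fun y x hxy =>
  r y x hxy + if k < y.val ∧ y.val ≤ l ∧ h ≤ x.val ∧ x.val < i then 1 else 0

/-- If `ω_{li} ≥ 1` and `ω_{kh} ≥ 1`, arbitrarily small rank-one perturbations of one factor
raise by one exactly the ranks in the rectangle `(k, l] × [h, i)`; they preserve the product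
of all factors unless `l = L` and `h = 0`. -/
theorem exists_perturb (θ : Weights d) (k : Fin L) (l i h : Fin (L + 1)) (hkl : k.succ ≤ l)
    (hik : i ≤ k.succ) (hhi : h < i) (hli : 1 ≤ mult (rankList θ) l i)
    (hkh : 1 ≤ mult (rankList θ) k.castSucc h) :
    ∃ u v, (∀ᶠ ε in 𝓝[≠] (0 : ℝ),
        rankList (perturb θ k u v ε) = addRect (rankList θ) l k i h) ∧
      (¬ (l = Fin.last L ∧ h = 0) → ∀ ε, mu (perturb θ k u v ε) = mu θ) := by
  have hk : k.castSucc < k.succ := k.castSucc_lt_succ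
  have hhk : h ≤ k.castSucc := Fin.le_castSucc_iff.2 (hhi.trans_le hik)
  obtain ⟨w, hw0, -, hw⟩ := exists_vector_of_one_le_mult θ l i (hik.trans hkl) hli
  obtain ⟨z, hz0, hz1, hz⟩ := exists_vector_of_one_le_mult θ k.castSucc h hhk hkh
  -- `v` kills everything reaching layer `k` from below layer `h`, but not the image of `z`.
  obtain ⟨v, hv0, hv1⟩ : ∃ v : Fin (d k.castSucc) → ℝ,
      (∀ x, (hx : x < h) → v ᵥ* subseq θ k.castSucc x (hx.le.trans hhk) = 0) ∧
      v ⬝ᵥ (subseq θ k.castSucc h hhk *ᵥ z) ≠ 0 := by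
    rcases Nat.eq_zero_or_pos h.val with h0 | h0
    · obtain ⟨v, -, hv⟩ := exists_dotProduct_eq_zero_of_notMem ⊥ (x := subseq θ k.castSucc h hhk *ᵥ z)
        (by simpa using hz1)
      exact ⟨v, fun x hx => absurd (Fin.lt_def.1 hx) (by omega), hv⟩
    · let p : Fin (L + 1) := ⟨h - 1, by omega⟩
      have hp : p < h := Fin.lt_def.2 (by simp only [p]; omega)
      obtain ⟨v, hv, hv'⟩ := exists_dotProduct_eq_zero_of_notMem _ (hz p hp)
      refine ⟨v, fun x hx => ?_, hv'⟩
      have hxp : x ≤ p := Fin.le_def.2 (by have := Fin.lt_def.1 hx; simp only [p]; omega)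
      refine dotProduct_eq_zero _ fun y => ?_
      rw [← dotProduct_mulVec, ← subseq_mulVec_subseq θ _ p x hxp (hp.le.trans hhk)]
      exact hv _ ⟨_, rfl⟩
  set u := subseq θ k.succ i hik *ᵥ w with hu
  have hyu : ∀ y (hy : k.succ ≤ y),
      subseq θ y k.succ hy *ᵥ u = subseq θ y i (hik.trans hy) *ᵥ w := fun y hy =>
    subseq_mulVec_subseq ..
  refine ⟨u, v, ?_, fun hne ε => ?_⟩
  · have key : ∀ᶠ ε in 𝓝[≠] (0 : ℝ), ∀ (y x : Fin (L + 1)) (hxy : x ≤ y),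
        rankList (perturb θ k u v ε) y x hxy = addRect (rankList θ) l k i h y x hxy := by
      simp only [eventually_all]
      intro y x hxy
      by_cases hyx : k.succ ≤ y ∧ x ≤ k.castSucc
      swap
      · refine Eventually.of_forall fun ε => ?_
        rw [addRect, if_neg, add_zero, rankList, subseq_perturb_of_notMem _ _ _ _ _ _ _ _ hyx,
          rankList]
        rintro ⟨h1, h2, h3, h4⟩
        refine hyx ⟨Fin.le_def.2 h1, Fin.le_def.2 ?_⟩
        have := Fin.le_def.1 hik
        simp only [Fin.val_succ, Fin.val_castSucc] at *
        omega
      obtain ⟨hy, hx⟩ := hyx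
      simp only [rankList, addRect, subseq_perturb θ k u v _ y x hy hx hxy]
      by_cases hyl : y ≤ l
      swap
      · refine Eventually.of_forall fun ε => ?_
        rw [hyu y hy, hw0 y (not_le.1 hyl), zero_vecMulVec, smul_zero, add_zero, if_neg, add_zero]
        exact fun h' => hyl h'.2.1
      by_cases hxh : h ≤ x
      swap
      · refine Eventually.of_forall fun ε => ?_
        rw [hv0 x (not_le.1 hxh), vecMulVec_zero_right, smul_zero, add_zero, if_neg, add_zero]
        exact fun h' => hxh h'.2.2.1
      by_cases hxi : x < i
      · filter_upwards [self_mem_nhdsWithin] with ε hε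
        rw [if_pos ⟨hy, hyl, hxh, hxi⟩]
        refine rank_add_smul_vecMulVec_of_notMem _ _ _ (subseq θ x h hxh *ᵥ z) ε hε ?_ ?_ ?_
        -- If the image of `u` in layer `y` came from layer `x < i`, pushing on to layer `l` would
        -- make the image of `w` come from there too.
        · rintro ⟨t, ht⟩
          refine hw x hxi ⟨t, ?_⟩
          rw [mulVecLin_apply] at ht ⊢
          rw [← subseq_mulVec_subseq θ l y x hxy hyl, ht, hyu y hy,
            subseq_mulVec_subseq]
        · rw [subseq_mulVec_subseq]
          exact hz0 y (hk.trans_le hy)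
        · rwa [← dotProduct_mulVec, subseq_mulVec_subseq]
      -- Here the image of `u` already lies in the range, as it comes from `w` through layer `x`;
      -- for small `ε` the critical scalar stays near `1`.
      · have hix : i ≤ x := not_lt.1 hxi
        have hcont : Continuous fun ε : ℝ =>
            1 + ε * ((v ᵥ* subseq θ k.castSucc x hx) ⬝ᵥ (subseq θ x i hix *ᵥ w)) := by fun_prop
        filter_upwards [nhdsWithin_le_nhds (hcont.continuousAt.eventually_ne (y := 0) (by simp))]
          with ε hε
        rw [if_neg (fun h' => hxi h'.2.2.2), add_zero, hyu y hy,
          ← subseq_mulVec_subseq θ y x i hix hxy]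
        exact rank_add_smul_vecMulVec_of_mem _ _ _ ε hε
    filter_upwards [key] with ε hε
    funext y x hxy
    exact hε y x hxy
  · rw [mu, mu, subseq_perturb θ k u v ε _ _ (Fin.le_last _) (Fin.zero_le _), hyu]
    rcases (Fin.le_last l).lt_or_eq with hl | hl
    · rw [hw0 _ hl, zero_vecMulVec, smul_zero, add_zero]
    · have h0 : 0 < h := Fin.pos_of_ne_zero fun h0 => hne ⟨hl, h0⟩
      rw [hv0 _ h0, vecMulVec_zero_right, smul_zero, add_zero]

end Perturbation
-- Finding a rectangle in a nonnegative array.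
section Combinatorics

/-- `t_{y, x-1}`, with the convention `t_{y, -1} = 0`. -/
def shiftPred (t : ℕ → ℕ → ℤ) (y : ℕ) : ℕ → ℤ
  | 0 => 0
  | x + 1 => t y x

/-- A nonzero nonnegative array supported strictly above the diagonal has a rectangle of positive
entries at two opposite corners of which the mixed second difference is negative. -/
theorem exists_rect (L : ℕ) (t : ℕ → ℕ → ℤ) (hnonneg : ∀ y x, 0 ≤ t y x)
    (htop : ∀ y x, L < y → t y x = 0) (hdiag : ∀ y x, y ≤ x → t y x = 0)
    (hne : ∃ y x, 0 < t y x) :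
    ∃ l k i h : ℕ, l ≤ L ∧ k < l ∧ h < i ∧ i ≤ k + 1 ∧
      t l i - shiftPred t l i - t (l + 1) i + shiftPred t (l + 1) i < 0 ∧
      t k h - shiftPred t k h - t (k + 1) h + shiftPred t (k + 1) h < 0 ∧
      ∀ y x, k < y → y ≤ l → h ≤ x → x < i → 0 < t y x := by
  classical
  -- `y₀` is the lowest nonzero row, `x₀` its first positive column, and `e` the first zero after
  -- `x₀`; the corner `(k, h)` will be `(y₀ - 1, x₀)`.
  obtain ⟨y₀, hy₀⟩ : ∃ y, y = Nat.find hne := ⟨_, rfl⟩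
  have hrow : ∃ x, 0 < t y₀ x := hy₀ ▸ Nat.find_spec hne
  have hbelow : ∀ y < y₀, ∀ x, t y x = 0 := fun y hy x =>
    le_antisymm (not_lt.1 fun h => Nat.find_min hne (hy₀ ▸ hy) ⟨x, h⟩) (hnonneg y x)
  obtain ⟨x₀, hx₀⟩ : ∃ x, x = Nat.find hrow := ⟨_, rfl⟩
  have hpos : 0 < t y₀ x₀ := hx₀ ▸ Nat.find_spec hrow
  have hleft : ∀ x < x₀, t y₀ x = 0 := fun x hx =>
    le_antisymm (not_lt.1 fun h => Nat.find_min hrow (hx₀ ▸ hx) h) (hnonneg y₀ x)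
  have hxy : x₀ < y₀ := not_le.1 fun h => hpos.ne' (hdiag _ _ h)
  have hend : ∃ e, x₀ < e ∧ t y₀ e = 0 := ⟨y₀, hxy, hdiag _ _ le_rfl⟩
  obtain ⟨e, he⟩ : ∃ e, e = Nat.find hend := ⟨_, rfl⟩
  have he0 : x₀ < e ∧ t y₀ e = 0 := he ▸ Nat.find_spec hend
  have hey : e ≤ y₀ := he ▸ Nat.find_min' hend ⟨hxy, hdiag _ _ le_rfl⟩
  have hmid : ∀ x, x₀ ≤ x → x < e → 0 < t y₀ x := by
    intro x h1 h2
    rcases h1.lt_or_eq with h | rfl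
    · exact lt_of_le_of_ne (hnonneg _ _) fun h0 =>
        Nat.find_min hend (he ▸ h2) ⟨h, h0.symm⟩
    · exact hpos
  obtain ⟨k, rfl⟩ : ∃ k, y₀ = k + 1 := ⟨y₀ - 1, by omega⟩
  have hcorner : t k x₀ - shiftPred t k x₀ - t (k + 1) x₀ + shiftPred t (k + 1) x₀ < 0 := by
    rw [hbelow k (Nat.lt_succ_self k)]
    cases x₀ with
    | zero => simpa [shiftPred] using hpos
    | succ x =>
      simp only [shiftPred, hbelow k (Nat.lt_succ_self k), hleft x (Nat.lt_succ_self x)]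
      omega
  by_contra hcon
  -- Without a valid corner `(l, i)`, the increments between successive rows are nonincreasing in
  -- `x` on `[x₀, e]`, as long as the block remains positive.
  have hdiff : ∀ y x, y ≤ L → k < y → x₀ ≤ x → x < e →
      (∀ y' x', k < y' → y' ≤ y → x₀ ≤ x' → x' < e → 0 < t y' x') →
      t (y + 1) (x + 1) - t y (x + 1) ≤ t (y + 1) x - t y x := by
    intro y x hy hky hx hxe hall
    by_contra hlt
    refine hcon ⟨y, k, x + 1, x₀, hy, hky, by omega, by omega, ?_, hcorner,
      fun y' x' h1 h2 h3 h4 => hall y' x' h1 h2 h3 (by omega)⟩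
    simp only [shiftPred]
    omega
  -- Hence the strict inequality between column `e` and columns `[x₀, e)` passes from row to row. It
  -- keeps the block positive forever, contradicting vanishing above row `L`.
  have hrows : ∀ n, (∀ m ≤ n, ∀ x, x₀ ≤ x → x < e → t (k + 1 + m) e < t (k + 1 + m) x) := by
    intro n
    induction n with
    | zero =>
      intro m hm x h1 h2
      obtain rfl : m = 0 := by omega
      rw [Nat.add_zero, he0.2]
      exact hmid x h1 h2
    | succ n ih =>
      intro m hm x h1 h2
      rcases hm.lt_or_eq with h | rfl
      · exact ih m (by omega) x h1 h2
      have hn : k + 1 + n ≤ L := by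
        by_contra hL
        have := ih n le_rfl x h1 h2
        rw [htop _ _ (not_le.1 hL), htop _ _ (not_le.1 hL)] at this
        exact lt_irrefl _ this
      have hanti : ∀ j x, x + j = e → x₀ ≤ x →
          t (k + 1 + n + 1) e - t (k + 1 + n) e ≤ t (k + 1 + n + 1) x - t (k + 1 + n) x := by
        intro j
        induction j with
        | zero =>
          intro x hx _
          obtain rfl : x = e := by omega
          exact le_rfl
        | succ j ihj =>
          intro x hx hxx
          refine (ihj (x + 1) (by omega) (by omega)).trans
            (hdiff _ x hn (by omega) hxx (by omega) fun y' x' h1' h2' h3' h4' => ?_)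
          have := ih (y' - (k + 1)) (by omega) x' h3' h4'
          rw [Nat.add_sub_cancel' (by omega)] at this
          exact (hnonneg _ _).trans_lt this
      have h3 := hanti (e - x) x (by omega) h1
      have h4 := ih n le_rfl x h1 h2
      rw [← Nat.add_assoc]
      omega
  have := hrows (L + 1) (L + 1) le_rfl x₀ le_rfl he0.1
  rw [htop _ _ (by omega), htop _ _ (by omega)] at this
  exact lt_irrefl _ this

end Combinatorics

/-! ### Moves as rectangles, and connecting comparable rank lists. -/

section Moves

variable {L : ℕ} {d : Fin (L + 1) → ℕ}

theorem entry_of_lt (r : RankList L) {k i : ℕ} (h : k < i) : entry r k i = 0 :=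
  dif_neg (by omega)

theorem rankList_ext {r s : RankList L} (h : ∀ y x, x ≤ y → entry r y x = entry s y x) :
    r = s := by
  funext k i hik
  have := h k i hik
  rwa [entry_eq r k i hik, entry_eq s k i hik, Nat.cast_inj] at this

/-- The interval multiplicities determine the rank list. -/
theorem rankList_ext_mult {r s : RankList L}
    (h : ∀ y x, x ≤ y → y ≤ L → mult r y x = mult s y x) : r = s := by
  -- Descending induction on rows from the zero row `L + 1`, then ascending along columns.
  have key : ∀ m y, L + 1 ≤ y + m → ∀ x, x ≤ y → entry r y x = entry s y x := by
    intro m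
    induction m with
    | zero => intro y hy x _; rw [entry_of_gt _ _ (by omega), entry_of_gt _ _ (by omega)]
    | succ m ih =>
      intro y hy x
      by_cases hyL : L < y
      · intro _; rw [entry_of_gt _ _ hyL, entry_of_gt _ _ hyL]
      induction x with
      | zero =>
        intro hx
        have h1 := h y 0 hx (by omega)
        have h2 := ih (y + 1) (by omega) 0 (by omega)
        simp only [mult, entryPred] at h1
        omega
      | succ x ihx =>
        intro hx
        have h1 := h y (x + 1) hx (by omega)
        have h2 := ih (y + 1) (by omega) (x + 1) (by omega)
        have h3 := ih (y + 1) (by omega) x (by omega)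
        have h4 := ihx (by omega)
        simp only [mult, entryPred] at h1
        omega
  exact rankList_ext fun y x hxy => key (L + 1) y (by omega) x hxy

/-- The bounds on `l` and `i` keep the rectangle where `entry` reads the list and not its default
`0`. -/
theorem entry_addRect (r : RankList L) {l k i h : ℕ} (hl : l ≤ L) (hik : i ≤ k + 1) (y x : ℕ) :
    entry (addRect r l k i h) y x =
      entry r y x + if k < y ∧ y ≤ l ∧ h ≤ x ∧ x < i then 1 else 0 := by
  by_cases hyx : x ≤ y ∧ y ≤ L
  · simp only [entry, dif_pos hyx, addRect]
    push_cast
    rfl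
  · rw [entry, entry, dif_neg hyx, dif_neg hyx, if_neg (by omega), add_zero]

theorem mult_addRect (r : RankList L) {l k i h : ℕ} (hl : l ≤ L) (hkl : k < l) (hik : i ≤ k + 1)
    (hhi : h < i) (y x : ℕ) :
    mult (addRect r l k i h) y x = mult r y x
      + (if y = l ∧ x = h then 1 else 0) + (if y = k ∧ x = i then 1 else 0)
      - (if y = l ∧ x = i then 1 else 0) - (if y = k ∧ x = h then 1 else 0) := by
  cases x with
  | zero =>
    simp only [mult, entryPred, entry_addRect r hl hik]
    split_ifs <;> omega
  | succ x =>
    simp only [mult, entryPred, entry_addRect r hl hik]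
    split_ifs <;> omega

/-- Both kinds of rank-one moves add a rectangle to the rank list. -/
theorem RankOneMove.exists_eq_addRect {r s : RankList L} (hrs : RankOneMove d r s) :
    ∃ l k i h : ℕ, l ≤ L ∧ k < l ∧ i ≤ k + 1 ∧ h < i ∧ 1 ≤ mult r l i ∧ 1 ≤ mult r k h ∧
      s = addRect r l k i h := by
  obtain ⟨-, -, l, k, i, h, hm | hm⟩ := hrs
  · refine ⟨l, k, i, h, hm.le_top, hm.lt_left, hm.adjacent.le, hm.lt_right, hm.enough_left,
      hm.enough_right, rankList_ext_mult fun y x hxy hy => ?_⟩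
    -- For a connecting move the fourth corner `(k, k + 1)` falls outside the triangle `x ≤ y`.
    rw [hm.mult_eq y x hxy hy, mult_addRect r hm.le_top hm.lt_left hm.adjacent.le hm.lt_right,
      if_neg (c := y = k ∧ x = i) (by have := hm.adjacent; omega)]
    push_cast
    ring
  · have hik : i ≤ k + 1 := hm.overlap.trans (Nat.le_succ k)
    refine ⟨l, k, i, h, hm.le_top, hm.lt_left, hik, hm.lt_right, hm.enough_left,
      hm.enough_right, rankList_ext_mult fun y x hxy hy => ?_⟩
    rw [hm.mult_eq y x hxy hy, mult_addRect r hm.le_top hm.lt_left hik hm.lt_right]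
    push_cast
    ring

theorem isValid_addRect {r : RankList L} (hr : IsValid d r) {l k i h : ℕ} (hl : l ≤ L)
    (hkl : k < l) (hik : i ≤ k + 1) (hhi : h < i) (hli : 1 ≤ mult r l i) (hkh : 1 ≤ mult r k h) :
    IsValid d (addRect r l k i h) := by
  obtain ⟨θ, rfl⟩ := hr
  obtain ⟨u, v, hev, -⟩ := exists_perturb θ ⟨k, by omega⟩ ⟨l, by omega⟩ ⟨i, by omega⟩
    ⟨h, by omega⟩ (Fin.le_def.2 hkl) (Fin.le_def.2 hik) (Fin.lt_def.2 hhi) hli hkh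
  obtain ⟨ε, hε⟩ := hev.exists
  exact ⟨_, hε⟩

theorem rankOneMove_addRect {r : RankList L} (hr : IsValid d r) {l k i h : ℕ} (hl : l ≤ L)
    (hkl : k < l) (hik : i ≤ k + 1) (hhi : h < i) (hli : 1 ≤ mult r l i) (hkh : 1 ≤ mult r k h) :
    RankOneMove d r (addRect r l k i h) := by
  refine ⟨hr, isValid_addRect hr hl hkl hik hhi hli hkh, l, k, i, h, ?_⟩
  rcases hik.lt_or_eq with hlt | heq
  · right
    refine ⟨hr, hl, hkl, Nat.lt_succ_iff.1 hlt, hhi, hli, hkh, fun y x hxy hy => ?_⟩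
    rw [mult_addRect r hl hkl hik hhi, Nat.cast_one]
  · left
    refine ⟨hr, hl, hkl, heq, hhi, hli, hkh, fun y x hxy hy => ?_⟩
    rw [mult_addRect r hl hkl hik hhi, Nat.cast_one, if_neg (c := y = k ∧ x = i) (by omega),
      add_zero]

theorem mult_nonneg {r : RankList L} (hr : IsValid d r) {k i : ℕ} (hik : i ≤ k) (hk : k ≤ L) :
    0 ≤ mult r k i := by
  obtain ⟨θ, rfl⟩ := hr
  exact mult_rankList_nonneg θ ⟨k, by omega⟩ ⟨i, by omega⟩ hik

theorem IsValid.apply_self {r : RankList L} (hr : IsValid d r) (j : Fin (L + 1)) :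
    r j j le_rfl = d j := by
  obtain ⟨θ, rfl⟩ := hr
  rw [rankList, subseq_self, Matrix.rank_one, Fintype.card_fin]

theorem entry_le_entry {r s : RankList L} (h : ∀ k i hik, r k i hik ≤ s k i hik) (y x : ℕ) :
    entry r y x ≤ entry s y x := by
  unfold entry
  split_ifs
  · exact_mod_cast h _ _ _
  · exact le_rfl

/-- A valid rank list is connected by moves to every larger valid one. -/
theorem reflTransGen_of_le {r s : RankList L} (hr : IsValid d r) (hs : IsValid d s)
    (hrs : ∀ k i hik, r k i hik ≤ s k i hik) : Relation.ReflTransGen (RankOneMove d) r s := by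
  obtain ⟨n, hn⟩ : ∃ n : ℕ, ∑ y ∈ Finset.range (L + 1), ∑ x ∈ Finset.range (L + 1),
      (entry s y x - entry r y x) < n := ⟨_ + 1, Int.lt_add_one_of_le (Int.self_le_toNat _)⟩
  induction n generalizing r with
  | zero =>
    refine absurd hn (not_lt.2 (Finset.sum_nonneg fun y _ => Finset.sum_nonneg fun x _ => ?_))
    exact sub_nonneg.2 (entry_le_entry hrs y x)
  | succ n ih =>
    by_cases hne : ∃ y x, 0 < entry s y x - entry r y x
    swap
    · have : r = s := rankList_ext fun y x _ => by
        push Not at hne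
        have h1 := hne y x
        have h2 := entry_le_entry hrs y x
        omega
      rw [this]
    obtain ⟨l, k, i, h, hl, hkl, hhi, hik, hd1, hd2, hrect⟩ := exists_rect L
      (fun y x => entry s y x - entry r y x)
      (fun y x => sub_nonneg.2 (entry_le_entry hrs y x))
      (fun y x hy => by simp only [entry_of_gt _ _ hy, sub_self])
      (fun y x hyx => by
        rcases hyx.lt_or_eq with hlt | rfl
        · simp only [entry_of_lt _ hlt, sub_self]
        by_cases hy : y ≤ L
        · have h1 := entry_eq r ⟨y, by omega⟩ ⟨y, by omega⟩ le_rfl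
          have h2 := entry_eq s ⟨y, by omega⟩ ⟨y, by omega⟩ le_rfl
          rw [hr.apply_self] at h1
          rw [hs.apply_self] at h2
          exact sub_eq_zero.2 (h2.trans h1.symm)
        · simp only [entry_of_gt _ _ (not_le.1 hy), sub_self])
      hne
    have hshift : ∀ y x, shiftPred (fun y x => entry s y x - entry r y x) y x =
        entryPred s y x - entryPred r y x := by
      intro y x
      cases x <;> simp [shiftPred, entryPred]
    simp only [hshift] at hd1 hd2
    -- The negative mixed difference of `s - r` says `mult s < mult r` at this corner, and `mult s`
    -- is nonnegative.
    have hli : 1 ≤ mult r l i := by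
      have := mult_nonneg hs (show i ≤ l by omega) hl
      simp only [mult] at this ⊢
      omega
    have hkh : 1 ≤ mult r k h := by
      have := mult_nonneg hs (show h ≤ k by omega) (show k ≤ L by omega)
      simp only [mult] at this ⊢
      omega
    refine Relation.ReflTransGen.head (rankOneMove_addRect hr hl hkl hik hhi hli hkh)
      (ih (isValid_addRect hr hl hkl hik hhi hli hkh) (fun y x hxy => ?_)
        (lt_of_lt_of_le ?_ (Int.lt_add_one_iff.1 (by exact_mod_cast hn))))
    · have h1 := hrs y x hxy
      have h2 := hrect y x
      simp only [entry_eq _ y x hxy] at h2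
      simp only [addRect]
      split_ifs with hc
      · have := h2 hc.1 hc.2.1 hc.2.2.1 hc.2.2.2
        omega
      · omega
    · have hle : ∀ y x, entry s y x - entry (addRect r l k i h) y x ≤
          entry s y x - entry r y x := by
        intro y x
        rw [entry_addRect r hl hik]
        split_ifs <;> omega
      refine Finset.sum_lt_sum (fun y _ => Finset.sum_le_sum fun x _ => hle y x)
        ⟨l, Finset.mem_range.2 (by omega), Finset.sum_lt_sum (fun x _ => hle l x)
          ⟨h, Finset.mem_range.2 (by omega), ?_⟩⟩
      rw [entry_addRect r hl hik, if_pos (by omega)]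
      omega

end Moves
-- Strata, their closures, and the equivalences.
section Strata

open Matrix Filter Topology

variable {L : ℕ} {d : Fin (L + 1) → ℕ}

/-- Change of basis in every layer. -/
theorem subseq_conj (θ : Weights d) (G H : (j : Fin (L + 1)) → Matrix (Fin (d j)) (Fin (d j)) ℝ)
    (hHG : ∀ j, H j * G j = 1) (k i : Fin (L + 1)) (hik : i ≤ k) :
    subseq (fun j => G j.succ * θ j * H j.castSucc : Weights d) k i hik =
      G k * subseq θ k i hik * H i := by
  have hself : ∀ j, (1 : Matrix (Fin (d j)) (Fin (d j)) ℝ) = G j * 1 * H j := fun j => by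
    rw [Matrix.mul_one, mul_eq_one_comm.1 (hHG j)]
  induction k using Fin.induction with
  | zero =>
    obtain rfl : i = 0 := le_antisymm hik (Fin.zero_le _)
    rw [subseq_self, subseq_self, ← hself]
  | succ k ih =>
    rcases hik.lt_or_eq with h' | h'
    · have hk : i ≤ k.castSucc := Fin.le_castSucc_iff.2 h'
      rw [subseq_succ _ k i hk, subseq_succ θ k i hk, ih hk]
      simp only [Matrix.mul_assoc]
      rw [← Matrix.mul_assoc (H _) (G _), hHG, Matrix.one_mul]
    · subst h'
      rw [subseq_self, subseq_self, ← hself]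

theorem rankList_conj (θ : Weights d)
    (G H : (j : Fin (L + 1)) → Matrix (Fin (d j)) (Fin (d j)) ℝ) (hHG : ∀ j, H j * G j = 1) :
    rankList (fun j => G j.succ * θ j * H j.castSucc : Weights d) = rankList θ := by
  funext k i hik
  rw [rankList, subseq_conj θ G H hHG, rank_mul_eq_left_of_isUnit_det,
    rank_mul_eq_right_of_isUnit_det, rankList]
  · exact isUnit_det_of_left_inverse (hHG k)
  · exact isUnit_det_of_right_inverse (hHG i)

theorem stratum_nonempty (hL : 1 ≤ L) (W : Matrix (Fin (d (Fin.last L))) (Fin (d 0)) ℝ)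
    {r : RankList L} (hr : IsValid d r) (hW : W.rank = r (Fin.last L) 0 (Fin.zero_le _)) :
    (stratum W r).Nonempty := by
  obtain ⟨θ, rfl⟩ := hr
  obtain ⟨P, P', Q, Q', hP, hQ, hPQ⟩ := exists_mul_mul_eq_of_rank_eq (mu θ) W hW.symm
  -- With distinct end layers, `Q` and `P` can be prescribed independently.
  have h0 : (0 : Fin (L + 1)) ≠ Fin.last L := fun h => by
    have := congrArg Fin.val h
    simp at this
    omega
  let G := Function.update (Function.update
    (fun j => (1 : Matrix (Fin (d j)) (Fin (d j)) ℝ)) 0 Q) (Fin.last L) P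
  let H := Function.update (Function.update
    (fun j => (1 : Matrix (Fin (d j)) (Fin (d j)) ℝ)) 0 Q') (Fin.last L) P'
  have hHG : ∀ j, H j * G j = 1 := by
    intro j
    by_cases h1 : j = Fin.last L
    · subst h1
      simpa [G, H] using hP
    by_cases h2 : j = 0
    · subst h2
      simpa [G, H, h0] using hQ
    · simp [G, H, h1, h2]
  refine ⟨_, ?_, rankList_conj θ G H hHG⟩
  change mu _ = W
  rw [mu, subseq_conj θ G H hHG, ← hPQ, mu]
  simp [G, H, h0]

/-- A stratum lies in the closure of the stratum obtained by a move, unless the move changes the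
rank of the product. -/
theorem stratum_subset_closure_addRect (W : Matrix (Fin (d (Fin.last L))) (Fin (d 0)) ℝ)
    {r : RankList L} {l k i h : ℕ} (hl : l ≤ L) (hkl : k < l) (hik : i ≤ k + 1) (hhi : h < i)
    (hli : 1 ≤ mult r l i) (hkh : 1 ≤ mult r k h) (hne : ¬ (l = L ∧ h = 0)) :
    stratum W r ⊆ closure (stratum W (addRect r l k i h)) := by
  rintro θ ⟨hθ, rfl⟩
  obtain ⟨u, v, hev, hmu⟩ := exists_perturb θ ⟨k, by omega⟩ ⟨l, by omega⟩ ⟨i, by omega⟩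
    ⟨h, by omega⟩ (Fin.le_def.2 hkl) (Fin.le_def.2 hik) (Fin.lt_def.2 hhi) hli hkh
  refine mem_closure_of_tendsto (tendsto_perturb θ _ u v) ?_
  filter_upwards [hev] with ε hε
  refine ⟨(hmu (fun hc => hne ⟨?_, ?_⟩) ε).trans hθ, hε⟩
  · simpa using congrArg Fin.val hc.1
  · simpa using congrArg Fin.val hc.2

theorem RankOneMove.le {r s : RankList L} (h : RankOneMove d r s) (k i : Fin (L + 1))
    (hik : i ≤ k) : r k i hik ≤ s k i hik := by
  obtain ⟨_, _, _, _, _, _, _, _, _, _, rfl⟩ := h.exists_eq_addRect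
  exact Nat.le_add_right _ _

theorem le_of_reflTransGen {r s : RankList L} (h : Relation.ReflTransGen (RankOneMove d) r s)
    (k i : Fin (L + 1)) (hik : i ≤ k) : r k i hik ≤ s k i hik := by
  induction h with
  | refl => exact le_rfl
  | tail _ h ih => exact ih.trans (h.le k i hik)

theorem stratum_subset_closure_of_reflTransGen
    (W : Matrix (Fin (d (Fin.last L))) (Fin (d 0)) ℝ) {r s : RankList L}
    (h : Relation.ReflTransGen (RankOneMove d) r s)
    (hrs : r (Fin.last L) 0 (Fin.zero_le _) = s (Fin.last L) 0 (Fin.zero_le _)) :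
    stratum W r ⊆ closure (stratum W s) := by
  induction h with
  | refl => exact subset_closure
  | @tail t s hrt hts ih =>
    -- The `(L, 0)` rank is monotone along the chain and agrees at its ends, so it is constant; no
    -- move may cover that entry.
    have h1 := le_of_reflTransGen hrt (Fin.last L) 0 (Fin.zero_le _)
    have h2 := hts.le (Fin.last L) 0 (Fin.zero_le _)
    refine (ih (by omega)).trans (closure_minimal ?_ isClosed_closure)
    obtain ⟨l, k, i, h, hl, hkl, hik, hhi, hli, hkh, rfl⟩ := hts.exists_eq_addRect
    refine stratum_subset_closure_addRect W hl hkl hik hhi hli hkh ?_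
    rintro ⟨rfl, rfl⟩
    have h3 : addRect t l k i 0 (Fin.last l) 0 (Fin.zero_le _) =
        t (Fin.last l) 0 (Fin.zero_le _) + 1 := by
      rw [addRect, if_pos ⟨by simpa using hkl, by simp, by simp, by simpa using hhi⟩]
    omega

theorem le_of_mem_closure_stratum {W : Matrix (Fin (d (Fin.last L))) (Fin (d 0)) ℝ}
    {s : RankList L} {θ : Weights d} (hθ : θ ∈ closure (stratum W s)) (k i : Fin (L + 1))
    (hik : i ≤ k) : rankList θ k i hik ≤ s k i hik := by
  have hopen : IsOpen {η : Weights d | rankList θ k i hik ≤ rankList η k i hik} :=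
    (isOpen_setOf_le_rank _).preimage (continuous_subseq k i hik)
  obtain ⟨η, hη, -, rfl⟩ := mem_closure_iff.1 hθ _ hopen (le_refl (rankList θ k i hik))
  exact hη

theorem tfae_stratum (hL : 1 ≤ L) (W : Matrix (Fin (d (Fin.last L))) (Fin (d 0)) ℝ)
    {r s : RankList L} (hr : IsValid d r) (hs : IsValid d s)
    (hWr : W.rank = r (Fin.last L) 0 (Fin.zero_le _))
    (hWs : W.rank = s (Fin.last L) 0 (Fin.zero_le _)) :
    List.TFAE [
      stratum W r ⊆ closure (stratum W s),
      (stratum W r ∩ closure (stratum W s)).Nonempty,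
      ∀ (k i : Fin (L + 1)) (h : i ≤ k), r k i h ≤ s k i h,
      Relation.ReflTransGen (RankOneMove d) r s] := by
  tfae_have 1 → 2 := fun h => by
    obtain ⟨θ, hθ⟩ := stratum_nonempty hL W hr hWr
    exact ⟨θ, hθ, h hθ⟩
  tfae_have 2 → 3 := by
    rintro ⟨θ, ⟨-, rfl⟩, hθ⟩
    exact le_of_mem_closure_stratum hθ
  tfae_have 3 → 4 := reflTransGen_of_le hr hs
  tfae_have 4 → 1 := fun h =>
    stratum_subset_closure_of_reflTransGen W h (hWr.symm.trans hWs)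
  tfae_finish

theorem frontierCondition_rankStratification (hL : 1 ≤ L)
    (W : Matrix (Fin (d (Fin.last L))) (Fin (d 0)) ℝ) :
    FrontierCondition (rankStratification W) := by
  rintro _ ⟨_, ⟨θ, hθ, rfl⟩, rfl⟩ _ ⟨_, ⟨η, hη, rfl⟩, rfl⟩ -
  have hθW : W.rank = rankList θ (Fin.last L) 0 (Fin.zero_le _) := congrArg rank hθ.symm
  have hηW : W.rank = rankList η (Fin.last L) 0 (Fin.zero_le _) := congrArg rank hη.symm
  rw [← Set.not_nonempty_iff_eq_empty]
  exact (em _).symm.imp id ((tfae_stratum hL W ⟨θ, rfl⟩ ⟨η, rfl⟩ hθW hηW).out 1 0).1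

end Strata
end LinNet

theorem mainTheorem3 {L : ℕ} (hL : 1 ≤ L) (d : Fin (L + 1) → ℕ)
    (W : Matrix (Fin (d (Fin.last L))) (Fin (d 0)) ℝ) :
    (∀ r s : LinNet.RankList L, LinNet.IsValid d r → LinNet.IsValid d s →
      W.rank = r (Fin.last L) 0 (Fin.zero_le _) →
      W.rank = s (Fin.last L) 0 (Fin.zero_le _) →
      (LinNet.stratum W r).Nonempty ∧ (LinNet.stratum W s).Nonempty ∧
      List.TFAE [
        LinNet.stratum W r ⊆ closure (LinNet.stratum W s),
        (LinNet.stratum W r ∩ closure (LinNet.stratum W s)).Nonempty,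
        ∀ (k i : Fin (L + 1)) (h : i ≤ k), r k i h ≤ s k i h,
        Relation.ReflTransGen (LinNet.RankOneMove d) r s]) ∧
    LinNet.FrontierCondition (LinNet.rankStratification W) :=
  ⟨fun _ _ hr hs hWr hWs => ⟨LinNet.stratum_nonempty hL W hr hWr,
    LinNet.stratum_nonempty hL W hs hWs, LinNet.tfae_stratum hL W hr hs hWr hWs⟩,
    LinNet.frontierCondition_rankStratification hL W⟩
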